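/- Let $n\ge 2$, $0<T<\infty$, $\mathbb{R}^n_T=\mathbb{R}^n\times(0,T)$, and let $S^{n\times n}$ be the set of real symmetric $n\times n$ matrices. Let $H:\mathbb{R}^n\times S^{n\times n}\to\mathbb{R}$ be continuous, with $H(q,X)\le H(q,Y)$ if $X\le Y$, $H(q,O)=0$, $H(\theta q,X)=H(q,X)$ for all $\theta\in\mathbb{R}$ (homogeneity of degree $k_1=k-1=0$ in $q$, so that $H(q,X)=H(X)$), $H(q,\theta X)=\theta H(q,X)$ for all $\theta>0$, and $\max_{|e|=1}H(e,-I)<0<\min_{|e|=1}H(e,I)$. Assume that $$\Lambda^{\sup}=\sup_{\lambda\in\mathbb{R}}\ \max_{|e|=1}H(e,\lambda e\otimes e+I)<\infty .$$ Let $h:\mathbb{R}^n\to\mathbb{R}$ be continuous with $\sup_{\mathbb{R}^n}h<\infty$, let $\chi:(0,T)\to\mathbb{R}$ be continuous and bounded, $\alpha=\sup_{(0,T)}|\chi|$, and let $\sigma\ge 0$. Let $-\infty\le m<\infty$ and let $Z:[m,\infty)\to[0,\infty)$ be non-increasing and continuous (for $m=-\infty$, $Z$ is defined on $\mathbb{R}$).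 Let $u:\mathbb{R}^n\times[0,T)\to\mathbb{R}$ be upper semicontinuous, with $\inf_{\mathbb{R}^n_T}u>m$ (no condition if $m=-\infty$) and $u(x,0)\le h(x)$ for all $x\in\mathbb{R}^n$, and suppose that $$H(D^2u+Z(u)\,Du\otimes Du)+\chi(t)|Du|^\sigma-u_t\ge 0\quad\text{in }\mathbb{R}^n_T$$ in the sense of viscosity, where $|Du|^0=1$. Fix $z\in\mathbb{R}^n$ and put $B^R_T=\{(x,t):|x-z|\le R,\ 0<t<T\}$ and $v(R)=\sup_{B^R_T}u$. The growth conditions below include that $v(R)<\infty$ for all $R$; $v(R)=e^{o(R^s)}$ means that $\log v^+(R)=o(R^s)$ as $R\to\infty$, where $v^+=\max(v,0)$, a condition regarded as satisfied if $v^+\equiv 0$. Then the following hold. (a) If $\sigma=0$ and $v(R)=e^{o(R^2)}$ as $R\to\infty$, then $$u(x,t)\le\sup_{\mathbb{R}^n}h+t\,\sup_{(0,T)}\chi\quad\text{for all }(x,t)\in\mathbb{R}^n_T.$$ (b) If $0<\sigma\le1$ and $v(R)=e^{o(R)}$ as $R\to\infty$, then $$u(x,t)\le\sup_{\mathbb{R}^n}h+K(1-\sigma)\sup_{(0,T)}\chi\quad\text{for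 all }(x,t)\in\mathbb{R}^n_T,$$ where $K=K(\alpha,\Lambda^{\sup},\sigma,T)\ge0$ depends only on $\alpha$, $\Lambda^{\sup}$, $\sigma$ and $T$. (c) If $1<\sigma<\infty$ and $v(R)=o(R^{\sigma^*})$ as $R\to\infty$, where $\sigma^*=\sigma/(\sigma-1)$, then $$u(x,t)\le\sup_{\mathbb{R}^n}h\quad\text{for all }(x,t)\in\mathbb{R}^n_T.$$ -/

import Mathlib

open Set Filter Topology Asymptotics

namespace PhragmenLindelof

/-- `ℝⁿ` with the Euclidean norm. -/
abbrev Euc (n : ℕ) := EuclideanSpace ℝ (Fin n)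

/-- The square matrices over `ℝ`. -/
abbrev Mat (n : ℕ) := Matrix (Fin n) (Fin n) ℝ

/-- `q ⊗ q`, the matrix with entries `qᵢ qⱼ`. -/
def tens {n : ℕ} (q : Euc n) : Mat n := Matrix.of fun i j => q i * q j

/-! The operator `H : ℝⁿ × Sⁿˣⁿ → ℝ` is written as a function of a vector and a square matrix.
All conditions on `H` below, and all its uses, concern symmetric matrices only; the values of `H`
at other matrices are irrelevant. -/

/-- Continuity on `ℝⁿ × Sⁿˣⁿ`, monotonicity (degenerate ellipticity), and `H(q, O) = 0`. -/
structure ConditionA {n : ℕ} (H : Euc n → Mat n → ℝ) : Prop where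
  cont : ContinuousOn (fun p : Euc n × Mat n => H p.1 p.2) {p | p.2.IsSymm}
  mono : ∀ (q : Euc n) (X Y : Mat n), X.IsSymm → Y.IsSymm → (Y - X).PosSemidef → H q X ≤ H q Y
  zero : ∀ q : Euc n, H q 0 = 0

/-- Homogeneity: of degree `k₁ ≥ 0` in the vector and positive homogeneity of degree one in the
matrix. -/
structure ConditionB {n : ℕ} (H : Euc n → Mat n → ℝ) (k₁ : ℝ) : Prop where
  nonneg : 0 ≤ k₁
  homog_vec : ∀ (θ : ℝ) (q : Euc n) (X : Mat n), X.IsSymm → H (θ • q) X = |θ| ^ k₁ * H q X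
  homog_mat : ∀ (θ : ℝ) (q : Euc n) (X : Mat n), X.IsSymm → 0 < θ → H q (θ • X) = θ * H q X

/-- `max_{|e|=1} H(e, -I) < 0 < min_{|e|=1} H(e, I)` (the extrema over the compact unit sphere
are attained, as `H` is continuous). -/
def ConditionC {n : ℕ} (H : Euc n → Mat n → ℝ) : Prop :=
  ∀ e : Euc n, ‖e‖ = 1 → H e (-1) < 0 ∧ 0 < H e 1

/-- `Λ_max(l) = max_{|e|=1} H(e, l e ⊗ e + I)`. -/
noncomputable def LambdaMax {n : ℕ} (H : Euc n → Mat n → ℝ) (l : ℝ) : ℝ :=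
  sSup ((fun e : Euc n => H e (l • tens e + 1)) '' {e | ‖e‖ = 1})

/-- `Λ^sup < ∞`. -/
def LambdaSupFinite {n : ℕ} (H : Euc n → Mat n → ℝ) : Prop :=
  BddAbove (range (LambdaMax H))

/-- `Λ^sup = sup_l Λ_max(l)`; meaningful under `LambdaSupFinite H`. -/
noncomputable def LambdaSup {n : ℕ} (H : Euc n → Mat n → ℝ) : ℝ :=
  ⨆ l : ℝ, LambdaMax H l

/-- The parabolic superjet of `u` at an interior point `(x, t)`: the triples `(a, p, X)`, with `X`
symmetric, such that as `(y, s) → (x, t)`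
`u(y,s) ≤ u(x,t) + a(s-t) + ⟨p, y-x⟩ + ½⟨X(y-x), y-x⟩ + o(|s-t| + |y-x|²)`. -/
def parabolicSuperjet {n : ℕ} (u : Euc n → ℝ → ℝ) (x : Euc n) (t : ℝ) :
    Set (ℝ × Euc n × Mat n) :=
  {j | j.2.2.IsSymm ∧ ∀ ε : ℝ, 0 < ε → ∀ᶠ w : Euc n × ℝ in 𝓝 (x, t),
    u w.1 w.2 ≤ u x t + j.1 * (w.2 - t) + inner ℝ j.2.1 (w.1 - x)
      + (1 / 2) * ((w.1 - x).ofLp ⬝ᵥ j.2.2.mulVec (w.1 - x).ofLp)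
      + ε * (|w.2 - t| + ‖w.1 - x‖ ^ 2)}

/-- `u` satisfies `H(Du, D²u + Z(u) Du ⊗ Du) + χ(t)|Du|^σ - u_t ≥ 0` in `ℝⁿ × (0, T)` in the sense
of viscosity. Here `|Du|^0 = 1`, also where `Du = 0`. -/
def IsViscositySubsolution {n : ℕ} (H : Euc n → Mat n → ℝ) (Z χ : ℝ → ℝ) (σ T : ℝ)
    (u : Euc n → ℝ → ℝ) : Prop :=
  ∀ (x : Euc n) (t : ℝ), t ∈ Ioo 0 T → ∀ (a : ℝ) (p : Euc n) (X : Mat n),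
    (a, p, X) ∈ parabolicSuperjet u x t →
      0 ≤ H p (X + Z (u x t) • tens p) + χ t * ‖p‖ ^ σ - a

/-- The values of `u` on the cylinder `B^R_T = {(x,t) : |x - z| ≤ R, 0 < t < T}`. -/
def cylinderValues {n : ℕ} (u : Euc n → ℝ → ℝ) (T : ℝ) (z : Euc n) (R : ℝ) : Set ℝ :=
  {y | ∃ (x : Euc n) (t : ℝ), ‖x - z‖ ≤ R ∧ t ∈ Ioo 0 T ∧ u x t = y}

/-- `sup_{B^R_T} u = o(R^β)` as `R → ∞`; in particular all these suprema are finite. -/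
def PowerGrowth {n : ℕ} (u : Euc n → ℝ → ℝ) (T : ℝ) (z : Euc n) (β : ℝ) : Prop :=
  (∀ R : ℝ, BddAbove (cylinderValues u T z R)) ∧
    (fun R : ℝ => sSup (cylinderValues u T z R)) =o[atTop] fun R : ℝ => R ^ β

/-- `sup_{B^R_T} u = e^{o(R^s)}` as `R → ∞`: the suprema `v(R)` are finite and
`log v⁺(R) = o(R^s)`. (`Real.log 0 = 0`, so that this holds if `u ≤ 0`.) -/
def ExpGrowth {n : ℕ} (u : Euc n → ℝ → ℝ) (T : ℝ) (z : Euc n) (s : ℝ) : Prop :=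
  (∀ R : ℝ, BddAbove (cylinderValues u T z R)) ∧
    (fun R : ℝ => Real.log (max (sSup (cylinderValues u T z R)) 0)) =o[atTop] fun R : ℝ => R ^ s

end PhragmenLindelof

open PhragmenLindelof

namespace PhragmenLindelof

/-! Compare `u` with the radial barrier `S + B t + η / (T - t) + ε e^{Kt} g(|x - z|²)`, where `S =
sup h`. With `y = x - z`, its gradient is parallel to `y` and its Hessian is `c I + d y ⊗ y`. The
term `Z(u) Du ⊗ Du` only changes `d`, and `Λ^sup < ∞` bounds `H` by `c Λ^sup` whatever `d` is
(`apply_le_LambdaSup`). Neither `Z` nor `g''` matters, and being a supersolution reduces to an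
inequality between `g` and `g'`, the hypothesis `hcond` of `le_barrier`.

The growth condition puts `u` below `ε g` far out, so a positive maximum of the difference would be
attained at an interior point, where the viscosity inequality fails. Letting `ε, η → 0` leaves `u ≤
S + B t` (`le_of_barrier`).

It remains to choose `g`: with `r = |x - z|`, it is `exp(r²)` for `σ = 0`, `exp √(1 + r²)` for `0 <
σ ≤ 1`, and `(1 + r²)^(σ*/2)` for `σ > 1`. These match the three growth rates. -/

/-! ### Superjets from radial test functions -/

/-- Second order Taylor expansion with Peano remainder. -/
theorem taylor_two_isLittleO {g g' : ℝ → ℝ} {g'' w : ℝ}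
    (hg : ∀ᶠ v in 𝓝 w, HasDerivAt g (g' v) v) (hg' : HasDerivAt g' g'' w) :
    (fun v => g v - g w - g' w * (v - w) - g'' / 2 * (v - w) ^ 2) =o[𝓝 w]
      fun v => (v - w) ^ 2 := by
  rw [isLittleO_iff]
  intro c hc
  have h1 := (hasDerivAt_iff_isLittleO.1 hg').def hc
  obtain ⟨ρ, hρ, hball⟩ := Metric.eventually_nhds_iff_ball.1 (hg.and h1)
  filter_upwards [Metric.ball_mem_nhds w hρ] with v hv
  have hr : ∀ y ∈ Metric.closedBall w |v - w|, y ∈ Metric.ball w ρ := fun y hy =>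
    lt_of_le_of_lt (Metric.mem_closedBall.1 hy) (by simpa [Real.dist_eq] using hv)
  -- Mean value inequality for the remainder, which vanishes at `w` and has derivative at most `c |v
  -- - w|` on this ball.
  have key := (convex_closedBall w |v - w|).norm_image_sub_le_of_norm_hasDerivWithin_le
    (f := fun y => g y - g w - g' w * (y - w) - g'' / 2 * (y - w) ^ 2)
    (f' := fun y => g' y - g' w - (y - w) * g'') (C := c * |v - w|) (x := w) (y := v)
    (fun y hy => by
      have h2 := (((hball y (hr y hy)).1.sub_const (g w)).sub
        (((hasDerivAt_id y).sub_const w).const_mul (g' w))).sub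
        ((((hasDerivAt_id y).sub_const w).pow 2).const_mul (g'' / 2))
      refine (h2.congr_deriv ?_).hasDerivWithinAt
      simp only [id]
      ring)
    (fun y hy => by
      have h2 := (hball y (hr y hy)).2
      simp only [smul_eq_mul] at h2
      refine h2.trans ?_
      have := Metric.mem_closedBall.1 hy
      rw [Real.dist_eq] at this
      rw [Real.norm_eq_abs]
      gcongr)
    (Metric.mem_closedBall_self (abs_nonneg _))
    (by simp [Metric.mem_closedBall, Real.dist_eq])
  simp only [Real.norm_eq_abs, abs_pow] at key ⊢
  calc _ = _ := by simp
    _ ≤ _ := key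
    _ = _ := by ring

variable {n : ℕ}

/-- Second order expansion of a function of `|y - z|²`. -/
theorem radial_expansion {g g' : ℝ → ℝ} {g'' : ℝ} (z x : Euc n)
    (hg : ∀ᶠ v in 𝓝 (‖x - z‖ ^ 2), HasDerivAt g (g' v) v)
    (hg' : HasDerivAt g' g'' (‖x - z‖ ^ 2)) :
    (fun y : Euc n => g (‖y - z‖ ^ 2) - g (‖x - z‖ ^ 2)
        - 2 * g' (‖x - z‖ ^ 2) * inner ℝ (x - z) (y - x)
        - (g' (‖x - z‖ ^ 2) * ‖y - x‖ ^ 2 + 2 * g'' * inner ℝ (x - z) (y - x) ^ 2))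
      =o[𝓝 x] fun y => ‖y - x‖ ^ 2 := by
  set w := ‖x - z‖ ^ 2 with hw
  have hΔ : ∀ y : Euc n, ‖y - z‖ ^ 2 - w = 2 * inner ℝ (x - z) (y - x) + ‖y - x‖ ^ 2 := by
    intro y
    have : y - z = (x - z) + (y - x) := by abel
    rw [this, norm_add_sq_real]
    ring
  have htend : Tendsto (fun y : Euc n => ‖y - z‖ ^ 2) (𝓝 x) (𝓝 w) :=
    (by fun_prop : Continuous fun y : Euc n => ‖y - z‖ ^ 2).tendsto x
  have hd0 : Tendsto (fun y : Euc n => ‖y - x‖) (𝓝 x) (𝓝 0) := by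
    have := (by fun_prop : Continuous fun y : Euc n => ‖y - x‖).tendsto x
    simpa using this
  have hin : (fun y : Euc n => inner ℝ (x - z) (y - x)) =O[𝓝 x] fun y => ‖y - x‖ :=
    IsBigO.of_bound ‖x - z‖ (Eventually.of_forall fun y => by
      simpa using norm_inner_le_norm (𝕜 := ℝ) (x - z) (y - x))
  have hd1 : (fun y : Euc n => ‖y - x‖ ^ 2) =o[𝓝 x] fun y => ‖y - x‖ := by
    have h1 : (fun y : Euc n => ‖y - x‖) =o[𝓝 x] fun _ => (1 : ℝ) :=
      (isLittleO_one_iff ℝ).2 hd0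
    simpa [pow_two] using h1.mul_isBigO (isBigO_refl (fun y : Euc n => ‖y - x‖) (𝓝 x))
  have hΔO : (fun y : Euc n => ‖y - z‖ ^ 2 - w) =O[𝓝 x] fun y => ‖y - x‖ := by
    simp only [hΔ]
    exact (hin.const_mul_left 2).add hd1.isBigO
  have h1 := ((taylor_two_isLittleO hg hg').comp_tendsto htend).trans_isBigO (hΔO.pow 2)
  -- What is left of `(‖y - z‖² - w)²` once the square of the inner product term is split off.
  have h2 : (fun y : Euc n => g'' / 2 * (4 * inner ℝ (x - z) (y - x) * ‖y - x‖ ^ 2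
      + ‖y - x‖ ^ 2 * ‖y - x‖ ^ 2)) =o[𝓝 x] fun y => ‖y - x‖ ^ 2 := by
    have h3 := (hin.const_mul_left 4).mul_isLittleO hd1
    have h4 := hd1.mul hd1
    simpa [pow_two] using (h3.add h4).const_mul_left (g'' / 2)
  refine (h1.add h2).congr_left fun y => ?_
  simp only [Function.comp, hΔ]
  ring

/-- The jet of a product of a function of time and a function of space plus a function of time. -/
theorem product_expansion {A b : ℝ → ℝ} {A' b' t : ℝ} {F P : Euc n → ℝ} {x : Euc n}
    (hA : HasDerivAt A A' t) (hb : HasDerivAt b b' t) (hF : ContinuousAt F x)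
    (hP : (fun y => F y - F x - P y) =o[𝓝 x] fun y => ‖y - x‖ ^ 2) :
    (fun w : Euc n × ℝ => b w.2 + A w.2 * F w.1 - (b t + A t * F x)
        - ((b' + A' * F x) * (w.2 - t) + A t * P w.1)) =o[𝓝 (x, t)]
      fun w => |w.2 - t| + ‖w.1 - x‖ ^ 2 := by
  have hfst : Tendsto (Prod.fst : Euc n × ℝ → Euc n) (𝓝 (x, t)) (𝓝 x) := continuousAt_fst
  have hsnd : Tendsto (Prod.snd : Euc n × ℝ → ℝ) (𝓝 (x, t)) (𝓝 t) := continuousAt_snd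
  have e1 : (fun w : Euc n × ℝ => w.2 - t) =O[𝓝 (x, t)] fun w => |w.2 - t| + ‖w.1 - x‖ ^ 2 :=
    IsBigO.of_bound 1 (Eventually.of_forall fun w => by
      rw [Real.norm_eq_abs, Real.norm_eq_abs, one_mul]
      exact le_trans (le_add_of_nonneg_right (by positivity)) (le_abs_self _))
  have e2 : (fun w : Euc n × ℝ => ‖w.1 - x‖ ^ 2) =O[𝓝 (x, t)]
      fun w => |w.2 - t| + ‖w.1 - x‖ ^ 2 :=
    IsBigO.of_bound 1 (Eventually.of_forall fun w => by
      rw [Real.norm_eq_abs, Real.norm_eq_abs, one_mul, abs_of_nonneg (by positivity)]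
      exact le_trans (le_add_of_nonneg_left (by positivity)) (le_abs_self _))
  have i1 := ((hasDerivAt_iff_isLittleO.1 hb).comp_tendsto hsnd).trans_isBigO e1
  have i2 := ((hasDerivAt_iff_isLittleO.1 hA).comp_tendsto hsnd).trans_isBigO e1
  have i3 := (hP.comp_tendsto hfst).trans_isBigO e2
  have i4 : (fun w : Euc n × ℝ => F w.1 - F x) =o[𝓝 (x, t)] fun _ => (1 : ℝ) := by
    rw [isLittleO_one_iff]
    simpa using ((hF.tendsto.comp hfst).sub_const (F x))
  have i5 : (fun w : Euc n × ℝ => A w.2 - A t) =O[𝓝 (x, t)]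
      fun w => |w.2 - t| + ‖w.1 - x‖ ^ 2 :=
    (hA.isBigO_sub.comp_tendsto hsnd).trans e1
  -- The cross term `(A s - A t)(F y - F x)` is `O(|s - t|) · o(1)`.
  have i6 := i5.mul_isLittleO i4
  simp only [mul_one] at i6
  refine (((i1.add (i2.const_mul_left (F x))).add (i3.const_mul_left (A t))).add i6).congr_left
    fun w => ?_
  simp only [Function.comp, smul_eq_mul]
  ring

theorem tens_isSymm (q : Euc n) : (tens q).IsSymm := by
  ext i j
  simp [tens, mul_comm]

theorem tens_smul (r : ℝ) (q : Euc n) : tens (r • q) = r ^ 2 • tens q := by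
  ext i j
  simp [tens]
  ring

theorem dotProduct_one_add_tens_mulVec (c d : ℝ) (q y : Euc n) :
    y.ofLp ⬝ᵥ (c • (1 : Mat n) + d • tens q).mulVec y.ofLp
      = c * ‖y‖ ^ 2 + d * inner ℝ q y ^ 2 := by
  have h1 : y.ofLp ⬝ᵥ y.ofLp = ‖y‖ ^ 2 := by
    rw [EuclideanSpace.real_norm_sq_eq]
    simp [dotProduct, pow_two]
  have h2 : (tens q).mulVec y.ofLp = (inner ℝ q y : ℝ) • q.ofLp := by
    ext i
    simp only [Matrix.mulVec, tens, dotProduct, Matrix.of_apply, Pi.smul_apply, smul_eq_mul,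
      PiLp.inner_apply, RCLike.inner_apply, conj_trivial, Finset.sum_mul]
    exact Finset.sum_congr rfl fun j _ => by ring
  have h3 : y.ofLp ⬝ᵥ q.ofLp = inner ℝ q y := by
    simp [dotProduct, PiLp.inner_apply]
  rw [Matrix.add_mulVec, Matrix.smul_mulVec, Matrix.smul_mulVec, Matrix.one_mulVec, h2,
    dotProduct_add, dotProduct_smul, dotProduct_smul, dotProduct_smul, h1, h3]
  simp only [smul_eq_mul]
  ring

/-- A local maximum of `u - ψ`, with `ψ(y,s) = b(s) + A(s) g(|y - z|²)`, puts the jet of `ψ` into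
the superjet of `u`. -/
theorem mem_parabolicSuperjet_of_radial {u : Euc n → ℝ → ℝ} {A b : ℝ → ℝ} {A' b' t : ℝ}
    {g g' : ℝ → ℝ} {g'' : ℝ} {z x : Euc n}
    (hA : HasDerivAt A A' t) (hb : HasDerivAt b b' t)
    (hg : ∀ᶠ v in 𝓝 (‖x - z‖ ^ 2), HasDerivAt g (g' v) v)
    (hg' : HasDerivAt g' g'' (‖x - z‖ ^ 2))
    (hmax : ∀ᶠ w : Euc n × ℝ in 𝓝 (x, t),
      u w.1 w.2 - (b w.2 + A w.2 * g (‖w.1 - z‖ ^ 2))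
        ≤ u x t - (b t + A t * g (‖x - z‖ ^ 2))) :
    (b' + A' * g (‖x - z‖ ^ 2), (2 * A t * g' (‖x - z‖ ^ 2)) • (x - z),
      (2 * A t * g' (‖x - z‖ ^ 2)) • (1 : Mat n) + (4 * A t * g'') • tens (x - z))
      ∈ parabolicSuperjet u x t := by
  refine ⟨(Matrix.isSymm_one.smul _).add ((tens_isSymm _).smul _), fun ε hε => ?_⟩
  have hF : ContinuousAt (fun y : Euc n => g (‖y - z‖ ^ 2)) x :=
    ContinuousAt.comp (f := fun y : Euc n => ‖y - z‖ ^ 2) hg.self_of_nhds.continuousAt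
      (by fun_prop)
  have hP := radial_expansion z x hg hg'
  have key := (product_expansion (F := fun y : Euc n => g (‖y - z‖ ^ 2))
    (P := fun y => 2 * g' (‖x - z‖ ^ 2) * inner ℝ (x - z) (y - x)
        + (g' (‖x - z‖ ^ 2) * ‖y - x‖ ^ 2 + 2 * g'' * inner ℝ (x - z) (y - x) ^ 2))
    hA hb hF (hP.congr_left fun y => by ring)).def hε
  filter_upwards [hmax, key] with w h1 h2
  rw [Real.norm_eq_abs, Real.norm_eq_abs,
    abs_of_nonneg (by positivity : 0 ≤ |w.2 - t| + ‖w.1 - x‖ ^ 2)] at h2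
  have h3 := (le_abs_self _).trans h2
  rw [dotProduct_one_add_tens_mulVec, real_inner_smul_left]
  linarith

/-! ### The operator on radial Hessians -/

theorem continuousOn_sphere {H : Euc n → Mat n → ℝ} (hA : ConditionA H) (l : ℝ) :
    ContinuousOn (fun e : Euc n => H e (l • tens e + 1)) {e | ‖e‖ = 1} := by
  have : Continuous fun e : Euc n => ((e, l • tens e + 1) : Euc n × Mat n) := by
    refine continuous_id.prodMk ((Continuous.const_smul ?_ l).add continuous_const)
    refine continuous_matrix fun i j => ?_
    simp only [tens, Matrix.of_apply]
    fun_prop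
  exact hA.cont.comp this.continuousOn fun e _ =>
    ((tens_isSymm _).smul _).add Matrix.isSymm_one

theorem le_LambdaSup {H : Euc n → Mat n → ℝ} (hA : ConditionA H) (hL : LambdaSupFinite H)
    (l : ℝ) {e : Euc n} (he : ‖e‖ = 1) : H e (l • tens e + 1) ≤ LambdaSup H := by
  have hc : IsCompact {e : Euc n | ‖e‖ = 1} := by
    have := isCompact_sphere (0 : Euc n) 1
    simpa [Metric.sphere] using this
  exact (le_csSup (hc.image_of_continuousOn (continuousOn_sphere hA l)).bddAbove
    (mem_image_of_mem _ he)).trans (le_ciSup hL l)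

/-- On matrices `c I + d y ⊗ y`, `c > 0`, with gradient parallel to `y`, the operator is at most
`c Λ^sup`. -/
theorem apply_le_LambdaSup (hn : 1 ≤ n) {H : Euc n → Mat n → ℝ} (hA : ConditionA H)
    (hB : ConditionB H 0) (hL : LambdaSupFinite H) {c : ℝ} (hc : 0 < c) (d k : ℝ) (y : Euc n) :
    H (k • y) (c • (1 : Mat n) + d • tens y) ≤ c * LambdaSup H := by
  obtain ⟨e, r, he, rfl⟩ : ∃ (e : Euc n) (r : ℝ), ‖e‖ = 1 ∧ y = r • e := by
    by_cases hy : y = 0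
    · exact ⟨EuclideanSpace.single ⟨0, hn⟩ 1, 0, by simp, by simp [hy]⟩
    · refine ⟨‖y‖⁻¹ • y, ‖y‖, ?_, ?_⟩
      · rw [norm_smul, norm_inv, norm_norm, inv_mul_cancel₀ (norm_ne_zero_iff.2 hy)]
      · rw [smul_smul, mul_inv_cancel₀ (norm_ne_zero_iff.2 hy), one_smul]
  have hs : ((d * r ^ 2 / c) • tens e + 1).IsSymm :=
    ((tens_isSymm _).smul _).add Matrix.isSymm_one
  have hX : c • (1 : Mat n) + d • tens (r • e) = c • ((d * r ^ 2 / c) • tens e + 1) := by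
    rw [tens_smul, smul_add, smul_smul, smul_smul, add_comm, mul_div_cancel₀ _ hc.ne']
  -- Degree 0 gives the factor `|k r| ^ 0 = 1` even when `k r = 0`, so a vanishing gradient needs no
  -- separate treatment.
  rw [hX, smul_smul, hB.homog_vec _ _ _ (hs.smul c), hB.homog_mat _ _ _ hs hc, Real.rpow_zero,
    one_mul]
  exact mul_le_mul_of_nonneg_left (le_LambdaSup hA hL _ he) hc.le

theorem LambdaSup_pos (hn : 1 ≤ n) {H : Euc n → Mat n → ℝ} (hA : ConditionA H)
    (hC : ConditionC H) (hL : LambdaSupFinite H) : 0 < LambdaSup H := by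
  have he : ‖(EuclideanSpace.single ⟨0, hn⟩ 1 : Euc n)‖ = 1 := by simp
  have := le_LambdaSup hA hL 0 he
  rw [zero_smul, zero_add] at this
  exact (hC _ he).2.trans_le this

/-! ### Comparison with a barrier -/

/-- Comparison of a subsolution with `S + B t + η / (T - t) + ε e^{Kt} g(|x - z|²)`. -/
theorem le_barrier (hn : 1 ≤ n) {H : Euc n → Mat n → ℝ} (hA : ConditionA H)
    (hB : ConditionB H 0) (hL : LambdaSupFinite H) {T : ℝ} {χ Z : ℝ → ℝ} {σ : ℝ}
    {u : Euc n → ℝ → ℝ}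
    (hu : UpperSemicontinuousOn (fun w : Euc n × ℝ => u w.1 w.2) (univ ×ˢ Ico 0 T))
    (hsub : IsViscositySubsolution H Z χ σ T u) {S : ℝ} (hu0 : ∀ x, u x 0 ≤ S) {z : Euc n}
    {g g' g'' : ℝ → ℝ} (hg : ∀ v, -1 < v → HasDerivAt g (g' v) v)
    (hg' : ∀ v, -1 < v → HasDerivAt g' (g'' v) v) (hpos : ∀ v, 0 ≤ v → 0 < g' v)
    (hnonneg : ∀ v, 0 ≤ v → 0 ≤ g v) {B K : ℝ} (hK : 0 ≤ K)
    (hcond : ∀ a t r, 0 < a → a ≤ 1 → t ∈ Ioo 0 T → 0 ≤ r →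
      2 * a * g' (r ^ 2) * LambdaSup H + χ t * (2 * a * g' (r ^ 2) * r) ^ σ
        ≤ B + K * a * g (r ^ 2))
    (hbdd : ∀ R, BddAbove (cylinderValues u T z R)) {ε η : ℝ} (hε : 0 < ε)
    (hεK : ε * Real.exp (K * T) ≤ 1) (hη : 0 < η)
    (hgrow : ∀ D, ∃ R, ∀ x t, t ∈ Ioo 0 T → R ≤ ‖x - z‖ → u x t + D ≤ ε * g (‖x - z‖ ^ 2))
    {x₀ : Euc n} {t₀ : ℝ} (ht₀ : t₀ ∈ Ioo 0 T) :
    u x₀ t₀ ≤ S + B * t₀ + η / (T - t₀) + ε * Real.exp (K * t₀) * g (‖x₀ - z‖ ^ 2) := by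
  by_contra! hlt
  set b : ℝ → ℝ := fun s => S + B * s + η / (T - s) with hbdef
  set A : ℝ → ℝ := fun s => ε * Real.exp (K * s) with hAdef
  have hAε : ∀ s, 0 ≤ s → ε ≤ A s := fun s hs =>
    le_mul_of_one_le_right hε.le (Real.one_le_exp (by positivity))
  have hlow : ∀ s, s ∈ Ioo 0 T → S - |B| * T + η / (T - s) ≤ b s := by
    intro s hs
    have h1 : -(|B| * T) ≤ B * s := by
      have h2 : |B * s| ≤ |B| * T := by
        rw [abs_mul, abs_of_pos hs.1]
        exact mul_le_mul_of_nonneg_left hs.2.le (abs_nonneg _)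
      linarith [neg_abs_le (B * s)]
    simp only [hbdef]
    linarith
  obtain ⟨R, hR⟩ := hgrow (-(S - |B| * T))
  have hout : ∀ x s, s ∈ Ioo 0 T → R ≤ ‖x - z‖ → u x s ≤ b s + A s * g (‖x - z‖ ^ 2) := by
    intro x s hs hx
    have h1 := hR x s hs hx
    have h2 := hlow s hs
    have h3 : 0 < η / (T - s) := div_pos hη (sub_pos.2 hs.2)
    have h4 := mul_le_mul_of_nonneg_right (hAε s hs.1.le) (hnonneg (‖x - z‖ ^ 2) (by positivity))
    linarith
  obtain ⟨N, hN⟩ := hbdd R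
  -- `Q` exceeds `N - (S - |B| T)`, and `η / (T - s) ≥ Q` once `s ≥ τ`: from time `τ` on the barrier
  -- dominates `u` inside the ball.
  set Q := |N - (S - |B| * T)| + 1 with hQ
  have hQpos : 0 < Q := by positivity
  set τ := T - η / Q with hτ
  have hτT : τ < T := by
    have : 0 < η / Q := by positivity
    linarith
  have hlate : ∀ x s, s ∈ Ioo 0 T → ‖x - z‖ ≤ R → τ ≤ s →
      u x s ≤ b s + A s * g (‖x - z‖ ^ 2) := by
    intro x s hs hx hτs
    have h1 : u x s ≤ N := hN ⟨x, s, hx, hs, rfl⟩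
    have h2 := hlow s hs
    have h3 : Q ≤ η / (T - s) := by
      rw [le_div_iff₀ (sub_pos.2 hs.2), mul_comm, ← le_div_iff₀ hQpos]
      linarith
    have h4 := mul_nonneg (hε.le.trans (hAε s hs.1.le)) (hnonneg (‖x - z‖ ^ 2) (by positivity))
    have h5 := le_abs_self (N - (S - |B| * T))
    linarith
  have hx₀ : ‖x₀ - z‖ ≤ R := by
    by_contra! hc
    exact absurd (hout x₀ t₀ ht₀ hc.le) (not_le.2 hlt)
  have ht₀τ : t₀ ≤ τ := by
    by_contra! hc
    exact absurd (hlate x₀ t₀ ht₀ hx₀ hc.le) (not_le.2 hlt)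
  set C : Set (Euc n × ℝ) := Metric.closedBall z R ×ˢ Icc 0 τ with hC
  have hCc : IsCompact C := (isCompact_closedBall z R).prod isCompact_Icc
  have hmem₀ : (x₀, t₀) ∈ C := ⟨by simpa [dist_eq_norm] using hx₀, ht₀.1.le, ht₀τ⟩
  have hψ : ContinuousOn (fun w : Euc n × ℝ => -(b w.2 + A w.2 * g (‖w.1 - z‖ ^ 2))) C := by
    have h1 : ContinuousOn (fun w : Euc n × ℝ => η / (T - w.2)) C :=
      continuousOn_const.div (by fun_prop) fun w hw => by
        have := hw.2.2
        exact (by linarith : 0 < T - w.2).ne'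
    have h2 : ContinuousOn (fun w : Euc n × ℝ => g (‖w.1 - z‖ ^ 2)) C := by
      have h3 : ContinuousOn g (Ioi (-1)) := fun v hv => (hg v hv).continuousAt.continuousWithinAt
      exact h3.comp (by fun_prop : Continuous fun w : Euc n × ℝ => ‖w.1 - z‖ ^ 2).continuousOn
        fun w _ => neg_one_lt_zero.trans_le (sq_nonneg ‖w.1 - z‖)
    refine ((ContinuousOn.add ?_ h1).add (ContinuousOn.mul ?_ h2)).neg <;> fun_prop
  have husc : UpperSemicontinuousOn
      (fun w : Euc n × ℝ => u w.1 w.2 + -(b w.2 + A w.2 * g (‖w.1 - z‖ ^ 2))) C :=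
    (hu.mono (prod_mono (subset_univ _) fun s hs => ⟨hs.1, hs.2.trans_lt hτT⟩)).add
      hψ.upperSemicontinuousOn
  obtain ⟨⟨x, t⟩, hxt, hmax⟩ := husc.exists_isMaxOn ⟨_, hmem₀⟩ hCc
  have hval : 0 < u x t + -(b t + A t * g (‖x - z‖ ^ 2)) := by
    have : 0 < u x₀ t₀ + -(b t₀ + A t₀ * g (‖x₀ - z‖ ^ 2)) := by
      simp only [hbdef, hAdef]
      linarith
    exact this.trans_le (hmax hmem₀)
  have ht0 : 0 < t := by
    refine lt_of_le_of_ne hxt.2.1 fun h0 => ?_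
    subst h0
    have h1 : 0 < η / (T - 0) := div_pos hη (by linarith [ht₀.1, ht₀.2])
    have h2 := mul_nonneg (hε.le.trans (hAε 0 le_rfl)) (hnonneg (‖x - z‖ ^ 2) (by positivity))
    have h3 := hu0 x
    simp only [hbdef, mul_zero, add_zero] at hval
    linarith
  have htT : t ∈ Ioo 0 T := ⟨ht0, hxt.2.2.trans_lt hτT⟩
  -- The maximum over `C` is positive, while the difference is nonpositive outside `C` at times in
  -- `(0, T)`. So this is a local maximum even if `(x, t)` lies on the lateral boundary or at `t =
  -- τ`.
  have hglobal : ∀ᶠ w : Euc n × ℝ in 𝓝 (x, t),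
      u w.1 w.2 - (b w.2 + A w.2 * g (‖w.1 - z‖ ^ 2))
        ≤ u x t - (b t + A t * g (‖x - z‖ ^ 2)) := by
    filter_upwards [continuousAt_snd.preimage_mem_nhds (Ioo_mem_nhds ht0 htT.2)] with w hw
    by_cases hwC : w ∈ C
    · have := hmax hwC
      simp only [mem_ofPred_eq] at this
      linarith
    · have : u w.1 w.2 ≤ b w.2 + A w.2 * g (‖w.1 - z‖ ^ 2) := by
        by_cases hwR : ‖w.1 - z‖ ≤ R
        · refine hlate _ _ hw hwR ?_
          by_contra! hc
          exact hwC ⟨by simpa [dist_eq_norm] using hwR, hw.1.le, hc.le⟩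
        · exact hout _ _ hw (not_le.1 hwR).le
      linarith
  have hAd : HasDerivAt A (K * A t) t := by
    refine ((((hasDerivAt_id t).const_mul K).exp).const_mul ε).congr_deriv ?_
    simp only [hAdef, id]
    ring
  have hTt : T - t ≠ 0 := (sub_pos.2 htT.2).ne'
  have hbd : HasDerivAt b (B + η / (T - t) ^ 2) t := by
    refine ((((hasDerivAt_id t).const_mul B).const_add S).add
      ((hasDerivAt_const t η).div ((hasDerivAt_id t).const_sub T) hTt)).congr_deriv ?_
    simp
  have hw : (-1 : ℝ) < ‖x - z‖ ^ 2 := neg_one_lt_zero.trans_le (sq_nonneg _)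
  have hjet := mem_parabolicSuperjet_of_radial hAd hbd
    (by filter_upwards [Ioi_mem_nhds hw] with v hv using hg v hv) (hg' _ hw) hglobal
  have hineq := hsub x t htT _ _ _ hjet
  have hApos : 0 < A t := hε.trans_le (hAε t ht0.le)
  have hA1 : A t ≤ 1 := by
    refine le_trans ?_ hεK
    simp only [hAdef]
    have := htT.2.le
    gcongr
  have hp := hpos (‖x - z‖ ^ 2) (by positivity)
  have hc : 0 < 2 * A t * g' (‖x - z‖ ^ 2) := by positivity
  -- The `Z` term is absorbed into the coefficient of `tens (x - z)`.
  rw [tens_smul, smul_smul, add_assoc, ← add_smul] at hineq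
  have hH := apply_le_LambdaSup hn hA hB hL hc (4 * A t * g'' (‖x - z‖ ^ 2)
    + Z (u x t) * (2 * A t * g' (‖x - z‖ ^ 2)) ^ 2) (2 * A t * g' (‖x - z‖ ^ 2)) (x - z)
  have hcd := hcond (A t) t ‖x - z‖ hApos hA1 htT (norm_nonneg _)
  rw [norm_smul, Real.norm_of_nonneg hc.le] at hineq
  have hηt : 0 < η / (T - t) ^ 2 := by positivity
  -- The jet inequality and `hcond` leave `η / (T - t)² ≤ 0`.
  linarith

theorem le_of_barrier (hn : 1 ≤ n) {H : Euc n → Mat n → ℝ} (hA : ConditionA H)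
    (hB : ConditionB H 0) (hL : LambdaSupFinite H) {T : ℝ} {χ Z : ℝ → ℝ} {σ : ℝ}
    {u : Euc n → ℝ → ℝ}
    (hu : UpperSemicontinuousOn (fun w : Euc n × ℝ => u w.1 w.2) (univ ×ˢ Ico 0 T))
    (hsub : IsViscositySubsolution H Z χ σ T u) {S : ℝ} (hu0 : ∀ x, u x 0 ≤ S) {z : Euc n}
    {g g' g'' : ℝ → ℝ} (hg : ∀ v, -1 < v → HasDerivAt g (g' v) v)
    (hg' : ∀ v, -1 < v → HasDerivAt g' (g'' v) v) (hpos : ∀ v, 0 ≤ v → 0 < g' v)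
    (hnonneg : ∀ v, 0 ≤ v → 0 ≤ g v) {B K : ℝ} (hK : 0 ≤ K)
    (hcond : ∀ a t r, 0 < a → a ≤ 1 → t ∈ Ioo 0 T → 0 ≤ r →
      2 * a * g' (r ^ 2) * LambdaSup H + χ t * (2 * a * g' (r ^ 2) * r) ^ σ
        ≤ B + K * a * g (r ^ 2))
    (hbdd : ∀ R, BddAbove (cylinderValues u T z R))
    (hgrow : ∀ ε, 0 < ε → ∀ D, ∃ R, ∀ x t, t ∈ Ioo 0 T → R ≤ ‖x - z‖ →
      u x t + D ≤ ε * g (‖x - z‖ ^ 2))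
    {x : Euc n} {t : ℝ} (ht : t ∈ Ioo 0 T) : u x t ≤ S + B * t := by
  have hlim : Tendsto (fun ε : ℝ => S + B * t + ε / (T - t)
      + ε * Real.exp (K * t) * g (‖x - z‖ ^ 2)) (𝓝[>] 0) (𝓝 (S + B * t)) := by
    have : Continuous fun ε : ℝ => S + B * t + ε / (T - t)
      + ε * Real.exp (K * t) * g (‖x - z‖ ^ 2) := by fun_prop
    simpa using (this.tendsto 0).mono_left nhdsWithin_le_nhds
  refine ge_of_tendsto hlim ?_
  -- `ε ≤ e^{-KT}` keeps the amplitude `ε e^{Kt}` at most 1; the same `ε` serves as `η`.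
  filter_upwards [Ioc_mem_nhdsGT (Real.exp_pos (-(K * T)))] with ε hε
  refine le_barrier hn hA hB hL hu hsub hu0 hg hg' hpos hnonneg hK hcond hbdd hε.1 ?_ hε.1
    (hgrow ε hε.1) ht
  calc ε * Real.exp (K * T) ≤ Real.exp (-(K * T)) * Real.exp (K * T) := by
        gcongr
        exact hε.2
    _ = 1 := by rw [← Real.exp_add]; simp

/-! ### Growth at infinity -/

theorem ExpGrowth.le_exp {u : Euc n → ℝ → ℝ} {T s : ℝ} {z : Euc n} (h : ExpGrowth u T z s)
    {c : ℝ} (hc : 0 < c) :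
    ∃ R, ∀ x t, t ∈ Ioo 0 T → R ≤ ‖x - z‖ → u x t ≤ Real.exp (c * ‖x - z‖ ^ s) := by
  obtain ⟨R, hR⟩ := eventually_atTop.1 (h.2.def hc)
  refine ⟨R, fun x t ht hx => ?_⟩
  have h1 := hR _ hx
  rw [Real.norm_of_nonneg (by positivity : 0 ≤ ‖x - z‖ ^ s)] at h1
  have h2 : u x t ≤ sSup (cylinderValues u T z ‖x - z‖) :=
    le_csSup (h.1 _) ⟨x, t, le_rfl, ht, rfl⟩
  set v := sSup (cylinderValues u T z ‖x - z‖)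
  rcases le_or_gt v 0 with hv | hv
  · exact h2.trans (hv.trans (Real.exp_pos _).le)
  · rw [max_eq_left hv.le] at h1
    exact h2.trans ((Real.log_le_iff_le_exp hv).1 ((le_abs_self _).trans h1))

theorem PowerGrowth.le_rpow {u : Euc n → ℝ → ℝ} {T β : ℝ} {z : Euc n}
    (h : PowerGrowth u T z β) {c : ℝ} (hc : 0 < c) :
    ∃ R, ∀ x t, t ∈ Ioo 0 T → R ≤ ‖x - z‖ → u x t ≤ c * ‖x - z‖ ^ β := by
  obtain ⟨R, hR⟩ := eventually_atTop.1 (h.2.def hc)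
  refine ⟨R, fun x t ht hx => ?_⟩
  have h1 := hR _ hx
  rw [Real.norm_of_nonneg (by positivity : 0 ≤ ‖x - z‖ ^ β)] at h1
  exact (le_csSup (h.1 _) ⟨x, t, le_rfl, ht, rfl⟩).trans ((le_abs_self _).trans h1)

/-- With `y = exp(r^s / 2) → ∞`, the right side is `ε y²`, and `ε y ≥ 1 + |D|` eventually. -/
theorem exists_add_le_mul_exp_sq {s : ℝ} (hs : 0 < s) {ε : ℝ} (hε : 0 < ε) (D : ℝ) :
    ∃ R, ∀ r, R ≤ r → Real.exp (1 / 2 * r ^ s) + D ≤ ε * Real.exp (r ^ s) := by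
  have hlim : Tendsto (fun r : ℝ => Real.exp (1 / 2 * r ^ s)) atTop atTop :=
    Real.tendsto_exp_atTop.comp ((tendsto_rpow_atTop hs).const_mul_atTop (by norm_num))
  obtain ⟨R, hR⟩ := eventually_atTop.1 (hlim.eventually_ge_atTop (max 1 ((1 + |D|) / ε)))
  refine ⟨R, fun r hr => ?_⟩
  have h1 := hR r hr
  set y := Real.exp (1 / 2 * r ^ s) with hy
  have h2 : Real.exp (r ^ s) = y * y := by
    rw [hy, ← Real.exp_add]
    congr 1
    ring
  have h3 : 1 + |D| ≤ ε * y := by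
    rw [mul_comm, ← div_le_iff₀ hε]
    exact (le_max_right _ _).trans h1
  have h4 : 1 ≤ y := (le_max_left _ _).trans h1
  rw [h2]
  nlinarith [le_abs_self D, abs_nonneg D, mul_nonneg (sub_nonneg.2 h4) (abs_nonneg D),
    mul_le_mul_of_nonneg_right h3 (zero_le_one.trans h4)]

/-- Linearizes the gradient term for `σ ≤ 1`: the constant `η ^ σ` goes into `B` and vanishes with
`η`, while the linear part, whose coefficient may blow up, goes into `K`. -/
theorem rpow_le_add_mul {σ η y : ℝ} (hσ : 0 < σ) (hσ1 : σ ≤ 1) (hη : 0 < η) (hy : 0 ≤ y) :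
    y ^ σ ≤ η ^ σ + η ^ (σ - 1) * y := by
  rcases le_total y η with h | h
  · exact (Real.rpow_le_rpow hy h hσ.le).trans (le_add_of_nonneg_right (by positivity))
  · have hy' := hη.trans_le h
    have h1 : y ^ σ = y ^ (σ - 1) * y := by
      rw [← Real.rpow_add_one hy'.ne', sub_add_cancel]
    rw [h1]
    have h2 := Real.rpow_le_rpow_of_nonpos hη h (sub_nonpos.2 hσ1)
    have h3 : 0 ≤ η ^ σ := by positivity
    have h4 := mul_le_mul_of_nonneg_right h2 hy
    linarith

/-! ### The three ranges of `σ` -/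

variable {H : Euc n → Mat n → ℝ} {T : ℝ} {χ Z : ℝ → ℝ} {σ : ℝ} {u : Euc n → ℝ → ℝ} {S : ℝ}
  {z : Euc n}

/-- Since `g' = g = exp`, the choice `K = 2 Λ^sup` turns the second order part of `hcond` into an
equality. -/
theorem le_of_expGrowth_two (hn : 1 ≤ n) (hA : ConditionA H) (hB : ConditionB H 0)
    (hC : ConditionC H) (hL : LambdaSupFinite H)
    (hu : UpperSemicontinuousOn (fun w : Euc n × ℝ => u w.1 w.2) (univ ×ˢ Ico 0 T))
    (hsub : IsViscositySubsolution H Z χ 0 T u) (hu0 : ∀ x, u x 0 ≤ S) {B : ℝ}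
    (hχ : ∀ t ∈ Ioo 0 T, χ t ≤ B) (hG : ExpGrowth u T z 2) {x : Euc n} {t : ℝ}
    (ht : t ∈ Ioo 0 T) : u x t ≤ S + B * t := by
  have hΛ := LambdaSup_pos hn hA hC hL
  refine le_of_barrier hn hA hB hL hu hsub hu0 (g := Real.exp) (g' := Real.exp)
    (g'' := Real.exp) (K := 2 * LambdaSup H) (fun v _ => Real.hasDerivAt_exp v)
    (fun v _ => Real.hasDerivAt_exp v) (fun v _ => Real.exp_pos v) (fun v _ => (Real.exp_pos v).le)
    (by positivity) ?_ hG.1 ?_ ht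
  · intro a t r _ _ ht _
    rw [Real.rpow_zero]
    linarith [hχ t ht]
  · intro ε hε D
    obtain ⟨R₁, h1⟩ := hG.le_exp (c := 1 / 2) (by norm_num)
    obtain ⟨R₂, h2⟩ := exists_add_le_mul_exp_sq (s := 2) (by norm_num) hε D
    refine ⟨max R₁ R₂, fun x t ht hx => ?_⟩
    have h3 := h1 x t ht ((le_max_left _ _).trans hx)
    have h4 := h2 _ ((le_max_right _ _).trans hx)
    rw [Real.rpow_two] at h3 h4
    linarith

theorem le_of_expGrowth_one (hn : 1 ≤ n) (hA : ConditionA H) (hB : ConditionB H 0)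
    (hC : ConditionC H) (hL : LambdaSupFinite H)
    (hu : UpperSemicontinuousOn (fun w : Euc n × ℝ => u w.1 w.2) (univ ×ˢ Ico 0 T))
    (hsub : IsViscositySubsolution H Z χ σ T u) (hu0 : ∀ x, u x 0 ≤ S) {α : ℝ} (hα : 0 ≤ α)
    (hχ : ∀ t ∈ Ioo 0 T, χ t ≤ α) (hσ : 0 < σ) (hσ1 : σ ≤ 1) (hG : ExpGrowth u T z 1)
    {x : Euc n} {t : ℝ} (ht : t ∈ Ioo 0 T) : u x t ≤ S := by
  have hΛ := LambdaSup_pos hn hA hC hL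
  have key : ∀ η : ℝ, 0 < η → u x t ≤ S + α * η ^ σ * t := by
    intro η hη
    -- Here `√(1 + v)` replaces `√v` to keep the barrier smooth at `x = z`.
    refine le_of_barrier hn hA hB hL hu hsub hu0 (g := fun v => Real.exp √(1 + v))
      (g' := fun v => Real.exp √(1 + v) * (1 / (2 * √(1 + v))))
      (g'' := fun v => Real.exp √(1 + v) * (1 / (2 * √(1 + v))) * (1 / (2 * √(1 + v)))
        + Real.exp √(1 + v) * (-(2 * (1 / (2 * √(1 + v)))) / (2 * √(1 + v)) ^ 2))
      (K := LambdaSup H + α * η ^ (σ - 1)) ?_ ?_ ?_ (fun v _ => (Real.exp_pos _).le)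
      (by positivity) ?_ hG.1 ?_ ht
    · intro v hv
      exact (((hasDerivAt_id v).const_add 1).sqrt (by simp only [id]; linarith)).exp
    · intro v hv
      have hv' : 0 < 1 + v := by linarith
      have hs : HasDerivAt (fun v : ℝ => √(1 + v)) (1 / (2 * √(1 + v))) v :=
        ((hasDerivAt_id v).const_add 1).sqrt hv'.ne'
      refine (hs.exp.mul ((hasDerivAt_const v (1 : ℝ)).div (hs.const_mul 2)
        (by positivity))).congr_deriv ?_
      simp only [Pi.div_apply]
      ring
    · intro v hv
      positivity
    · intro a t r ha _ ht hr
      have hs1 : 1 ≤ √(1 + r ^ 2) := Real.one_le_sqrt.2 (by nlinarith)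
      have hrs : r ≤ √(1 + r ^ 2) := Real.le_sqrt_of_sq_le (by linarith)
      set s := √(1 + r ^ 2)
      have hs : 0 < s := by linarith
      set E := Real.exp s
      have hE : 0 < E := Real.exp_pos s
      have e1 : 2 * a * (E * (1 / (2 * s))) = a * E / s := by
        field_simp
      rw [e1]
      have h1 : a * E / s ≤ a * E := div_le_self (by positivity) hs1
      have h2 : a * E / s * r ≤ a * E := by
        rw [div_mul_eq_mul_div, div_le_iff₀ hs]
        gcongr
      have h3 : (a * E / s * r) ^ σ ≤ η ^ σ + η ^ (σ - 1) * (a * E) :=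
        (Real.rpow_le_rpow (by positivity) h2 hσ.le).trans
          (rpow_le_add_mul hσ hσ1 hη (by positivity))
      have h4 : χ t * (a * E / s * r) ^ σ ≤ α * (η ^ σ + η ^ (σ - 1) * (a * E)) :=
        (mul_le_mul_of_nonneg_right (hχ t ht) (by positivity)).trans
          (mul_le_mul_of_nonneg_left h3 hα)
      have h5 := mul_le_mul_of_nonneg_right h1 hΛ.le
      linarith
    · intro ε hε D
      obtain ⟨R₁, h1⟩ := hG.le_exp (c := 1 / 2) (by norm_num)
      obtain ⟨R₂, h2⟩ := exists_add_le_mul_exp_sq (s := 1) (by norm_num) hε D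
      refine ⟨max R₁ R₂, fun x t ht hx => ?_⟩
      have h3 := h1 x t ht ((le_max_left _ _).trans hx)
      have h4 := h2 _ ((le_max_right _ _).trans hx)
      have h5 : ‖x - z‖ ≤ √(1 + ‖x - z‖ ^ 2) := Real.le_sqrt_of_sq_le (by linarith)
      have h6 := mul_le_mul_of_nonneg_left (Real.exp_le_exp.2 h5) hε.le
      rw [Real.rpow_one] at h3 h4
      linarith
  have hlim : Tendsto (fun η : ℝ => S + α * η ^ σ * t) (𝓝[>] 0) (𝓝 S) := by
    have h1 := (((Real.continuousAt_rpow_const 0 σ (Or.inr hσ.le)).tendsto.const_mul α).mul_const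
      t).const_add S
    simpa [Real.zero_rpow hσ.ne'] using h1.mono_left nhdsWithin_le_nhds
  exact ge_of_tendsto hlim (eventually_nhdsWithin_of_forall key)

theorem le_of_powerGrowth (hn : 1 ≤ n) (hA : ConditionA H) (hB : ConditionB H 0)
    (hC : ConditionC H) (hL : LambdaSupFinite H)
    (hu : UpperSemicontinuousOn (fun w : Euc n × ℝ => u w.1 w.2) (univ ×ˢ Ico 0 T))
    (hsub : IsViscositySubsolution H Z χ σ T u) (hu0 : ∀ x, u x 0 ≤ S) {α : ℝ} (hα : 0 ≤ α)
    (hχ : ∀ t ∈ Ioo 0 T, χ t ≤ α) (hσ : 1 < σ) (hG : PowerGrowth u T z (σ / (σ - 1)))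
    {x : Euc n} {t : ℝ} (ht : t ∈ Ioo 0 T) : u x t ≤ S := by
  have hΛ := LambdaSup_pos hn hA hC hL
  have hσ' : 0 < σ - 1 := by linarith
  set β := σ / (σ - 1) with hβdef
  have hβ : 0 < β := by positivity
  -- `β` is the conjugate exponent, so `|Dg|^σ`, of order `r^((β - 1) σ)`, grows exactly like `g`.
  have hβσ : (β - 1) * σ = β := by
    rw [hβdef]
    field_simp
    ring
  have h0 : u x t ≤ S + 0 * t := by
    refine le_of_barrier hn hA hB hL hu hsub hu0 (g := fun v => (1 + v) ^ (β / 2))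
      (g' := fun v => β / 2 * (1 + v) ^ (β / 2 - 1))
      (g'' := fun v => β / 2 * ((β / 2 - 1) * (1 + v) ^ (β / 2 - 1 - 1)))
      (K := β * LambdaSup H + α * β ^ σ) ?_ ?_ ?_ ?_ (by positivity) ?_ hG.1 ?_ ht
    · intro v hv
      have hv' : (1 + v : ℝ) ≠ 0 := by linarith
      refine (((hasDerivAt_id v).const_add 1).rpow_const (p := β / 2) (Or.inl hv')).congr_deriv ?_
      simp
    · intro v hv
      have hv' : (1 + v : ℝ) ≠ 0 := by linarith
      refine ((((hasDerivAt_id v).const_add 1).rpow_const (p := β / 2 - 1)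
        (Or.inl hv')).const_mul (β / 2)).congr_deriv ?_
      simp
    · intro v hv
      positivity
    · intro v hv
      positivity
    · intro a t r ha ha1 ht hr
      have hw1 : 1 ≤ 1 + r ^ 2 := by nlinarith
      have hrs : r ≤ (1 + r ^ 2) ^ (1 / 2 : ℝ) := by
        rw [← Real.sqrt_eq_rpow]
        exact Real.le_sqrt_of_sq_le (by linarith)
      set w := 1 + r ^ 2
      have hw : 0 < w := by linarith
      have h1 : w ^ (β / 2 - 1) ≤ w ^ (β / 2) :=
        Real.rpow_le_rpow_of_exponent_le hw1 (by linarith)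
      have h2 : 2 * a * (β / 2 * w ^ (β / 2 - 1)) * r ≤ a * (β * w ^ ((β - 1) / 2)) := by
        have e : w ^ ((β - 1) / 2) = w ^ (β / 2 - 1) * w ^ (1 / 2 : ℝ) := by
          rw [← Real.rpow_add hw]
          congr 1
          ring
        rw [e]
        calc _ = a * β * w ^ (β / 2 - 1) * r := by ring
          _ ≤ a * β * w ^ (β / 2 - 1) * w ^ (1 / 2 : ℝ) := by gcongr
          _ = _ := by ring
      have h3 : (2 * a * (β / 2 * w ^ (β / 2 - 1)) * r) ^ σ ≤ a * (β ^ σ * w ^ (β / 2)) := by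
        refine (Real.rpow_le_rpow (by positivity) h2 (by linarith)).trans ?_
        rw [Real.mul_rpow ha.le (by positivity), Real.mul_rpow hβ.le (by positivity),
          ← Real.rpow_mul hw.le, show (β - 1) / 2 * σ = β / 2 by linarith]
        refine mul_le_mul_of_nonneg_right ?_ (by positivity)
        -- Needs `a ≤ 1`: for `σ > 1` the gradient term is superlinear in the amplitude.
        calc a ^ σ ≤ a ^ (1 : ℝ) := Real.rpow_le_rpow_of_exponent_ge ha ha1 hσ.le
          _ = a := Real.rpow_one a
      have h4 := (mul_le_mul_of_nonneg_right (hχ t ht)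
        (by positivity : 0 ≤ (2 * a * (β / 2 * w ^ (β / 2 - 1)) * r) ^ σ)).trans
          (mul_le_mul_of_nonneg_left h3 hα)
      have h5 : 2 * a * (β / 2 * w ^ (β / 2 - 1)) * LambdaSup H
          ≤ a * β * LambdaSup H * w ^ (β / 2) := by
        calc _ = a * β * LambdaSup H * w ^ (β / 2 - 1) := by ring
          _ ≤ _ := by gcongr
      linarith
    · intro ε hε D
      -- Half of `ε` absorbs `u`, the other half `D`.
      obtain ⟨R₁, h1⟩ := hG.le_rpow (half_pos hε)
      obtain ⟨R₂, h2⟩ := eventually_atTop.1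
        ((tendsto_rpow_atTop hβ).eventually_ge_atTop (D / (ε / 2)))
      refine ⟨max R₁ R₂, fun x t ht hx => ?_⟩
      have h3 := h1 x t ht ((le_max_left _ _).trans hx)
      have h4 := h2 _ ((le_max_right _ _).trans hx)
      rw [div_le_iff₀ (half_pos hε)] at h4
      have h5 : ‖x - z‖ ^ β ≤ (1 + ‖x - z‖ ^ 2) ^ (β / 2) := by
        have e : ‖x - z‖ ^ β = (‖x - z‖ ^ 2) ^ (β / 2) := by
          rw [← Real.rpow_natCast, ← Real.rpow_mul (norm_nonneg _)]
          congr 1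
          push_cast
          ring
        rw [e]
        exact Real.rpow_le_rpow (by positivity) (by linarith) (by positivity)
      have h6 := mul_le_mul_of_nonneg_left h5 hε.le
      linarith
  simpa using h0

end PhragmenLindelof

theorem theorem2p9 :
    ∃ K : ℝ → ℝ → ℝ → ℝ → ℝ, (∀ α L σ T : ℝ, 0 ≤ K α L σ T) ∧
    ∀ (n : ℕ) (_hn : 2 ≤ n)
      (H : Euc n → Mat n → ℝ) (_hA : ConditionA H) (_hB : ConditionB H 0) (_hC : ConditionC H)
      (_hL : LambdaSupFinite H)
      (T : ℝ) (_hT : 0 < T)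
      (h : Euc n → ℝ) (_hh : Continuous h) (_hh' : BddAbove (range h))
      (χ : ℝ → ℝ) (_hχ : ContinuousOn χ (Ioo 0 T))
      (_hχ' : BddAbove ((fun t => |χ t|) '' Ioo 0 T))
      -- `m = ⊥` stands for `m = -∞`, in which case the condition `inf u > m` is dropped
      (m : WithBot ℝ) (Z : ℝ → ℝ)
      (_hZ : ContinuousOn Z {s : ℝ | m ≤ (s : WithBot ℝ)})
      (_hZ' : AntitoneOn Z {s : ℝ | m ≤ (s : WithBot ℝ)})
      (_hZ'' : ∀ s : ℝ, m ≤ (s : WithBot ℝ) → 0 ≤ Z s)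
      (u : Euc n → ℝ → ℝ)
      (_hu : UpperSemicontinuousOn (fun w : Euc n × ℝ => u w.1 w.2) (univ ×ˢ Ico 0 T))
      (_hum : m = ⊥ ∨
        ∃ c : ℝ, m < (c : WithBot ℝ) ∧ ∀ (x : Euc n) (t : ℝ), t ∈ Ioo 0 T → c ≤ u x t)
      (_hu0 : ∀ x : Euc n, u x 0 ≤ h x)
      (z : Euc n) (σ : ℝ) (_hsub : IsViscositySubsolution H Z χ σ T u),
      (σ = 0 → ExpGrowth u T z 2 →
        ∀ (x : Euc n) (t : ℝ), t ∈ Ioo 0 T →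
          u x t ≤ sSup (range h) + sSup (χ '' Ioo 0 T) * t) ∧
      (0 < σ → σ ≤ 1 → ExpGrowth u T z 1 →
        ∀ (x : Euc n) (t : ℝ), t ∈ Ioo 0 T →
          u x t ≤ sSup (range h)
            + K (sSup ((fun s => |χ s|) '' Ioo 0 T)) (LambdaSup H) σ T * (1 - σ)
              * sSup (χ '' Ioo 0 T)) ∧
      (1 < σ → PowerGrowth u T z (σ / (σ - 1)) →
        ∀ (x : Euc n) (t : ℝ), t ∈ Ioo 0 T → u x t ≤ sSup (range h)) := by
  -- In part (b) already `u ≤ sup h`, so `K = 0` serves. For `σ < 1` and `α > 0` no other value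
  -- would, as `u = h = 0` with `χ = -α` shows.
  refine ⟨fun _ _ _ _ => 0, fun _ _ _ _ => le_rfl, ?_⟩
  intro n hn H hA hB hC hL T hT h _ hh' χ _ hχ' m Z _ _ _ u hu _ hu0 z σ hsub
  have hn1 : 1 ≤ n := by omega
  have hS : ∀ x, u x 0 ≤ sSup (range h) := fun x =>
    (hu0 x).trans (le_csSup hh' (mem_range_self x))
  have hα : ∀ t ∈ Ioo 0 T, |χ t| ≤ sSup ((fun s => |χ s|) '' Ioo 0 T) := fun t ht =>
    le_csSup hχ' (mem_image_of_mem _ ht)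
  have hχα : ∀ t ∈ Ioo 0 T, χ t ≤ sSup ((fun s => |χ s|) '' Ioo 0 T) := fun t ht =>
    (le_abs_self _).trans (hα t ht)
  have hα0 : 0 ≤ sSup ((fun s => |χ s|) '' Ioo 0 T) :=
    (abs_nonneg _).trans (hα (T / 2) ⟨by linarith, by linarith⟩)
  refine ⟨?_, ?_, ?_⟩
  · rintro rfl hG x t ht
    refine le_of_expGrowth_two hn1 hA hB hC hL hu hsub hS (fun s hs => ?_) hG ht
    refine le_csSup ⟨sSup ((fun s => |χ s|) '' Ioo 0 T), ?_⟩ (mem_image_of_mem _ hs)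
    rintro _ ⟨r, hr, rfl⟩
    exact hχα r hr
  · intro hσ hσ1 hG x t ht
    simpa using le_of_expGrowth_one hn1 hA hB hC hL hu hsub hS hα0 hχα hσ hσ1 hG ht
  · intro hσ hG x t ht
    exact le_of_powerGrowth hn1 hA hB hC hL hu hsub hS hα0 hχα hσ hG ht
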